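/- **Setting.** Let $k,n\ge 0$ be integers and let $M$ be a smooth manifold of dimension $n+kn$ with a $k$-symplectic structure $(\omega_0^1,\dots,\omega_0^k,V)$: the $\omega_0^A$ are smooth closed $2$-forms on $M$ with $\bigcap_{A}\ker\omega_0^A=\{0\}$, and $V$ is an integrable tangent distribution of rank $nk$ with $\omega_0^A|_{V\times V}=0$ for all $A$. On $\mathbb R^k\times M$, with projections $\pi_{\mathbb R^k},\pi_M$ and coordinates $t^1,\dots,t^k$ on $\mathbb R^k$, put $\eta^A=\pi_{\mathbb R^k}^*dt^A$, $\omega^A=\pi_M^*\omega_0^A$ and $R_A=\partial/\partial t^A$. Let $H\in C^\infty(\mathbb R^k\times M)$. A solution of the Hamilton–de Donder–Weyl equations on an open set $U_0\subset\mathbb R^k$ is a smooth section $\psi:U_0\to\mathbb R^k\times M$ of $\pi_{\mathbb R^k}$ such that for all $t\in U_0$ $$\sum_{A=1}^k i\Big(\psi_*(t)\Big(\frac{\partial}{\partial t^A}\Big|_t\Big)\Big)(\omega^A\circ\psi)=\Big[dH-\sum_{A=1}^k R_A(H)\,\eta^A\Big]\circ\psi .$$ **Theorem (Noether's theorem).**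 Let $Y$ be an infinitesimal $k$-cosymplectic Noether symmetry, i.e. a smooth vector field on $\mathbb R^k\times M$ with $L(Y)\omega^A=0$, $i(Y)\eta^A=0$ for $A=1,\dots,k$, and $L(Y)H=0$. Then every $p\in\mathbb R^k\times M$ has an open neighbourhood $U_p$ with the following properties. 1. There are smooth $1$-forms $\theta^1,\dots,\theta^k$ on $U_p$ with $\omega^A=-d\theta^A$ on $U_p$. 2. For every such choice of $\theta^1,\dots,\theta^k$ there are $\zeta^1,\dots,\zeta^k\in C^\infty(U_p)$ with $L(Y)\theta^A=d\zeta^A$ on $U_p$. 3. For every such choice of the $\theta^A$ and $\zeta^A$, the functions $F^A=i(Y)\theta^A-\zeta^A$ are smooth on $U_p$ and satisfy $i(Y)\omega^A=dF^A$ on $U_p$, and $F=(F^1,\dots,F^k)$ is a conservation law on $U_p$: for every solution $\psi:U_0\to\mathbb R^k\times M$ of the Hamilton–de Donder–Weyl equations and every $t\in U_0$ with $\psi(t)\in U_p$, $$\sum_{A=1}^k\frac{\partial (F^A\circ\psi)}{\partial t^A}\Big|_t=0 .$$ -/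

import Mathlib

open scoped Manifold ContDiff
open Bundle

namespace KCosymplectic

noncomputable section

section Forms

variable {E : Type*} [NormedAddCommGroup E] [NormedSpace ℝ E]
  {H : Type*} [TopologicalSpace H] (I : ModelWithCorners ℝ E H)
  (M : Type*) [TopologicalSpace M] [ChartedSpace H M]

/-- Vector fields on `M` (smoothness is a separate predicate). -/
abbrev VField : Type _ := (x : M) → TangentSpace I x

/-- Fields of covectors on `M` (smoothness is a separate predicate). -/
abbrev CovectorField : Type _ := (x : M) → (TangentSpace I x →L[ℝ] ℝ)

/-- Fields of bilinear forms on the tangent spaces of `M`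
(smoothness and skew-symmetry are separate predicates). -/
abbrev BilinField : Type _ := (x : M) → (TangentSpace I x →L[ℝ] TangentSpace I x →L[ℝ] ℝ)

variable {I M}

/-- The vector field `X` is of class `C^∞` at `x` (hence near `x`, to every finite order). -/
def SmoothFieldAt [IsManifold I 1 M] (X : VField I M) (x : M) : Prop :=
  ContMDiffAt I I.tangent ∞ (fun y => (⟨y, X y⟩ : TangentBundle I M)) x

/-- The vector field `X` is of class `C^∞`. -/
def SmoothField [IsManifold I 1 M] (X : VField I M) : Prop :=
  ContMDiff I I.tangent ∞ (fun y => (⟨y, X y⟩ : TangentBundle I M))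

/-- `θ` is a differential `1`-form of class `C^∞` on the set `U`. -/
def IsOneFormOn [IsManifold I 1 M] (θ : CovectorField I M) (U : Set M) : Prop :=
  ContMDiffOn I (I.prod 𝓘(ℝ, E →L[ℝ] ℝ)) ∞
    (fun x => TotalSpace.mk' (E →L[ℝ] ℝ)
      (E := fun x : M => (TangentSpace I x →L[ℝ] ℝ)) x (θ x)) U

/-- `ω` is a differential `2`-form of class `C^∞` on `M`. -/
def IsTwoForm [IsManifold I 1 M] (Ω : BilinField I M) : Prop :=
  (∀ x v, Ω x v v = 0) ∧
  ContMDiff I (I.prod 𝓘(ℝ, E →L[ℝ] E →L[ℝ] ℝ)) ∞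
    (fun x => TotalSpace.mk' (E →L[ℝ] E →L[ℝ] ℝ)
      (E := fun x : M => (TangentSpace I x →L[ℝ] TangentSpace I x →L[ℝ] ℝ)) x (Ω x))

/-- The derivative `X(f)` of the function `f` along the vector field `X`. -/
def dirDeriv (X : VField I M) (f : M → ℝ) (x : M) : ℝ := mvfderiv I f x (X x)

/-- The Lie bracket `[X, Y]`. -/
def bracket (X Y : VField I M) : VField I M := VectorField.mlieBracket I X Y

/-- The function `(dθ)(X, Y) = X(θ(Y)) - Y(θ(X)) - θ([X, Y])`. -/
def extDerivOne (θ : CovectorField I M) (X Y : VField I M) (x : M) : ℝ :=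
  dirDeriv X (fun y => θ y (Y y)) x - dirDeriv Y (fun y => θ y (X y)) x
    - θ x (bracket X Y x)

/-- The function `(dω)(X, Y, Z) = X(ω(Y, Z)) - Y(ω(X, Z)) + Z(ω(X, Y))
- ω([X, Y], Z) + ω([X, Z], Y) - ω([Y, Z], X)`. -/
def extDerivTwo (Ω : BilinField I M) (X Y Z : VField I M) (x : M) : ℝ :=
  dirDeriv X (fun y => Ω y (Y y) (Z y)) x - dirDeriv Y (fun y => Ω y (X y) (Z y)) x
    + dirDeriv Z (fun y => Ω y (X y) (Y y)) x
    - Ω x (bracket X Y x) (Z x) + Ω x (bracket X Z x) (Y x) - Ω x (bracket Y Z x) (X x)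

/-- The function `(L(Y)θ)(X) = Y(θ(X)) - θ([Y, X])`. -/
def lieDerivOne (Y : VField I M) (θ : CovectorField I M) (X : VField I M) (x : M) : ℝ :=
  dirDeriv Y (fun y => θ y (X y)) x - θ x (bracket Y X x)

/-- The function `(L(Y)ω)(X, Z) = Y(ω(X, Z)) - ω([Y, X], Z) - ω(X, [Y, Z])`. -/
def lieDerivTwo (Y : VField I M) (Ω : BilinField I M) (X Z : VField I M) (x : M) : ℝ :=
  dirDeriv Y (fun y => Ω y (X y) (Z y)) x - Ω x (bracket Y X x) (Z x)
    - Ω x (X x) (bracket Y Z x)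

/-- `dω = 0`. -/
def IsClosedTwoForm [IsManifold I 1 M] (Ω : BilinField I M) : Prop :=
  ∀ (x : M) (X Y Z : VField I M), SmoothFieldAt X x → SmoothFieldAt Y x → SmoothFieldAt Z x →
    extDerivTwo Ω X Y Z x = 0

/-- `ω = - dθ` on `U`. -/
def EqNegExtDerivOn [IsManifold I 1 M] (Ω : BilinField I M) (θ : CovectorField I M)
    (U : Set M) : Prop :=
  ∀ x ∈ U, ∀ X Y : VField I M, SmoothFieldAt X x → SmoothFieldAt Y x →
    Ω x (X x) (Y x) = - extDerivOne θ X Y x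

/-- `L(Y)θ = dζ` on `U`. -/
def LieDerivOneEqDiffOn [IsManifold I 1 M] (Y : VField I M) (θ : CovectorField I M) (ζ : M → ℝ)
    (U : Set M) : Prop :=
  ∀ x ∈ U, ∀ X : VField I M, SmoothFieldAt X x → lieDerivOne Y θ X x = mvfderiv I ζ x (X x)

/-- `L(Y)ω = 0`. -/
def LieDerivTwoEqZero [IsManifold I 1 M] (Y : VField I M) (Ω : BilinField I M) : Prop :=
  ∀ (x : M) (X Z : VField I M), SmoothFieldAt X x → SmoothFieldAt Z x →
    lieDerivTwo Y Ω X Z x = 0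

/-- The distribution `V` is integrable: around every point there is a chart of the smooth atlas
in which `V` becomes a constant subspace `W`, so that the slices parallel to `W` are integral
manifolds of `V`. -/
def IsIntegrableDistribution (V : (x : M) → Submodule ℝ (TangentSpace I x)) : Prop :=
  ∀ x : M, ∃ e ∈ IsManifold.maximalAtlas I ∞ M, x ∈ e.source ∧
    ∃ W : Submodule ℝ E, ∀ y ∈ e.source, ∀ v : TangentSpace I y,
      v ∈ V y ↔ (mvfderiv I (e.extend I) y v : E) ∈ W

end Forms

/-- A `k`-symplectic structure `(ω^1, …, ω^k, V)` on a manifold `M` of dimension `n + k n`. -/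
structure KSymplecticStructure (k n : ℕ) (M : Type*) [TopologicalSpace M]
    [ChartedSpace (EuclideanSpace ℝ (Fin (n + k * n))) M]
    [IsManifold (𝓡 (n + k * n)) ∞ M] where
  /-- the forms `ω₀^A` -/
  form : Fin k → BilinField (𝓡 (n + k * n)) M
  isTwoForm : ∀ A, IsTwoForm (form A)
  closed : ∀ A, IsClosedTwoForm (form A)
  /-- the intersection of the kernels is zero -/
  nondegenerate : ∀ (x : M) (v : TangentSpace (𝓡 (n + k * n)) x),
    (∀ A w, form A x v w = 0) → v = 0
  /-- the distribution `V` -/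
  dist : (x : M) → Submodule ℝ (TangentSpace (𝓡 (n + k * n)) x)
  finrank_dist : ∀ x, Module.finrank ℝ (dist x) = n * k
  integrable : IsIntegrableDistribution dist
  isotropic : ∀ A x, ∀ v ∈ dist x, ∀ w ∈ dist x, form A x v w = 0

/-- `ℝ^k` -/
abbrev Rk (k : ℕ) : Type := EuclideanSpace ℝ (Fin k)

/-- The model of the product manifold `ℝ^k × M`, with `dim M = n + k n`. -/
abbrev prodModel (k n : ℕ) : ModelWithCorners ℝ (Rk k × EuclideanSpace ℝ (Fin (n + k * n)))
    (ModelProd (Rk k) (EuclideanSpace ℝ (Fin (n + k * n)))) :=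
  (𝓡 k).prod (𝓡 (n + k * n))

/-- The standard basis vector `∂/∂t^A` of `ℝ^k`. -/
def basisVec {k : ℕ} (A : Fin k) : Rk k := EuclideanSpace.single A 1

section System

variable {k n : ℕ} {M : Type*} [TopologicalSpace M]
  [ChartedSpace (EuclideanSpace ℝ (Fin (n + k * n))) M]

/-- `η^A = π_{ℝ^k}^* dt^A`, the differential of `(t, x) ↦ t^A` on `ℝ^k × M`. -/
def eta (A : Fin k) : CovectorField (prodModel k n) (Rk k × M) :=
  fun p => mvfderiv (prodModel k n) (fun q : Rk k × M => q.1 A) p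

/-- The Reeb vector field `R_A = ∂/∂t^A` on `ℝ^k × M`. -/
def reeb (A : Fin k) : VField (prodModel k n) (Rk k × M) :=
  fun _ => ((basisVec A : Rk k), (0 : EuclideanSpace ℝ (Fin (n + k * n))))

variable [IsManifold (𝓡 (n + k * n)) ∞ M]

/-- `ω^A = π_M^* ω₀^A` on `ℝ^k × M`. -/
def omega (S : KSymplecticStructure k n M) (A : Fin k) :
    BilinField (prodModel k n) (Rk k × M) :=
  fun p =>
    let D := mfderiv (prodModel k n) (𝓡 (n + k * n)) (Prod.snd : Rk k × M → M) p
    (ContinuousLinearMap.precomp ℝ D).comp ((S.form A p.2).comp D)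

/-- `(π_M^* ω₀^A)(v, w) = ω₀^A((π_M)_* v, (π_M)_* w)`. -/
theorem omega_apply (S : KSymplecticStructure k n M) (A : Fin k) (p : Rk k × M)
    (v w : TangentSpace (prodModel k n) p) :
    omega S A p v w
      = S.form A p.2
          (mfderiv (prodModel k n) (𝓡 (n + k * n)) (Prod.snd : Rk k × M → M) p v)
          (mfderiv (prodModel k n) (𝓡 (n + k * n)) (Prod.snd : Rk k × M → M) p w) :=
  rfl

/-- `ψ_*(t)(∂/∂t^A)` -/
def pushBasis (ψ : Rk k → Rk k × M) (t : Rk k) (A : Fin k) :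
    TangentSpace (prodModel k n) (ψ t) :=
  mfderiv (𝓡 k) (prodModel k n) ψ t (basisVec A)

/-- `ψ`, restricted to the open set `U₀`, is a smooth section of `π_{ℝ^k}` which solves the
Hamilton-de Donder-Weyl equations
`∑ i(ψ_*(t)(∂/∂t^A)) (ω^A ∘ ψ) = (dH - ∑ R_A(H) η^A) ∘ ψ`. -/
structure IsHDWSolutionOn (S : KSymplecticStructure k n M) (H : Rk k × M → ℝ)
    (U₀ : Set (Rk k)) (ψ : Rk k → Rk k × M) : Prop where
  smooth : ContMDiffOn (𝓡 k) (prodModel k n) ∞ ψ U₀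
  isSection : ∀ t ∈ U₀, (ψ t).1 = t
  equation : ∀ t ∈ U₀, ∀ v : TangentSpace (prodModel k n) (ψ t),
    ∑ A, omega S A (ψ t) (pushBasis (n := n) ψ t A) v
      = mvfderiv (prodModel k n) H (ψ t) v
        - ∑ A, dirDeriv (reeb (n := n) A) H (ψ t) * eta (n := n) A (ψ t) v

/-- The divergence `∑ ∂G^A/∂t^A`. -/
def divergence (G : Rk k → Fin k → ℝ) (t : Rk k) : ℝ :=
  ∑ A, fderiv ℝ (fun s => G s A) t (basisVec A)

/-- The functions `F^1, …, F^k`, considered on the open set `U` of `ℝ^k × M`, are a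
conservation law: they are smooth on `U`, and for every solution `ψ` (on any open
set `U₀` of `ℝ^k`) the divergence of `F ∘ ψ` vanishes wherever `F ∘ ψ` is defined. -/
def IsConservationLawOn (S : KSymplecticStructure k n M) (H : Rk k × M → ℝ)
    (U : Set (Rk k × M)) (F : Fin k → Rk k × M → ℝ) : Prop :=
  (∀ A, ContMDiffOn (prodModel k n) 𝓘(ℝ, ℝ) ∞ (F A) U) ∧
  ∀ (U₀ : Set (Rk k)) (ψ : Rk k → Rk k × M), IsOpen U₀ → IsHDWSolutionOn S H U₀ ψ →
    ∀ t ∈ U₀, ψ t ∈ U → divergence (fun s A => F A (ψ s)) t = 0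

/-- `Y` is an infinitesimal `k`-cosymplectic Noether symmetry of `(ℝ^k × M, H)`. -/
structure IsInfinitesimalNoetherSymmetry (S : KSymplecticStructure k n M)
    (H : Rk k × M → ℝ) (Y : VField (prodModel k n) (Rk k × M)) : Prop where
  smooth : SmoothField Y
  lieDeriv_omega : ∀ A, LieDerivTwoEqZero Y (omega S A)
  eta_eq_zero : ∀ A p, eta A p (Y p) = 0
  lieDeriv_hamiltonian : ∀ p, dirDeriv Y H p = 0

/-- `θ^1, …, θ^k` are smooth `1`-forms on `U` with `ω^A = - dθ^A` on `U`. -/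
def ArePotentialsOn (S : KSymplecticStructure k n M) (U : Set (Rk k × M))
    (θ : Fin k → CovectorField (prodModel k n) (Rk k × M)) : Prop :=
  ∀ A, IsOneFormOn (θ A) U ∧ EqNegExtDerivOn (omega S A) (θ A) U

/-- `ζ^1, …, ζ^k` are smooth functions on `U` with `L(Y)θ^A = dζ^A` on `U`. -/
def AreLiePrimitivesOn (Y : VField (prodModel k n) (Rk k × M)) (U : Set (Rk k × M))
    (θ : Fin k → CovectorField (prodModel k n) (Rk k × M)) (ζ : Fin k → Rk k × M → ℝ) : Prop :=
  ∀ A, ContMDiffOn (prodModel k n) 𝓘(ℝ, ℝ) ∞ (ζ A) U ∧ LieDerivOneEqDiffOn Y (θ A) (ζ A) U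

/-- `F^A = i(Y)θ^A - ζ^A` -/
def noetherFunction (Y : VField (prodModel k n) (Rk k × M))
    (θ : Fin k → CovectorField (prodModel k n) (Rk k × M)) (ζ : Fin k → Rk k × M → ℝ)
    (A : Fin k) (p : Rk k × M) : ℝ :=
  θ A p (Y p) - ζ A p

end System

end

end KCosymplectic

open KCosymplectic

/-!
The conservation law rests on one identity: if `ω = - dθ` and `L(Y)θ = dζ`, then Cartan's formula
`L(Y)θ = i(Y)dθ + d(i(Y)θ)` gives `i(Y)ω = d(i(Y)θ - ζ)`
(`EqNegExtDerivOn.lieDerivOne_eq`, `LieDerivOneEqDiffOn.bilin_eq_mvfderiv`). Once `i(Y)ω^A = dF^A`,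
the divergence of `F ∘ ψ` along a solution `ψ` is
`∑ ω^A(Y, ψ_* ∂/∂t^A) = - ∑ ω^A(ψ_* ∂/∂t^A, Y)`, and by the field equations this is
`- L(Y)H + ∑ R_A(H) η^A(Y) = 0`
(`IsInfinitesimalNoetherSymmetry.isConservationLawOn`).

What remains is the existence of the local data, for which the neighbourhood is the preimage of a
ball under a chart. A potential `θ` exists by the Poincaré lemma for `2`-forms on a ball, proved
with the radial homotopy operator (`exists_primitive_two_form`). For every potential `θ`, a
primitive `ζ` of `L(Y)θ` is obtained as `i(Y)θ - f`, where `df = i(Y)ω`: the form `i(Y)ω` is closed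
since `L(Y)ω = 0` and `dω = 0`, so that `f` comes from the Poincaré lemma for `1`-forms
(`exists_hamiltonian_chartBall`).

Exterior derivatives, Lie derivatives and closedness are defined by testing against vector fields
that are smooth at a point. They are turned into statements about ordinary derivatives by passing
to a chart: fields of vectors and covectors and bilinear forms have representatives on the model
space, Lie brackets become brackets of representatives (`fieldRep_bracket`), and the fields with a
constant representative commute. In a product chart, the representative of `ω^A` is the pullback of
that of `ω₀^A` along the projection (`bilinRep_omega`), so smoothness and closedness of `ω^A` in
charts follow from those of `ω₀^A`.
-/

namespace KCosymplectic

/-! ### The Poincaré lemma for `2`-forms on a ball -/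

section Poincare

universe u

variable {E : Type u} [NormedAddCommGroup E] [NormedSpace ℝ E]

section ParametricIntegral

variable {F : Type u} [NormedAddCommGroup F] [NormedSpace ℝ F]

theorem hasFDerivAt_curry_left {G : E × ℝ → F} (hG : ContDiff ℝ 1 G) (y : E) (s : ℝ) :
    HasFDerivAt (fun y => G (y, s))
      ((fderiv ℝ G (y, s)).comp (ContinuousLinearMap.inl ℝ E ℝ)) y :=
  (hG.differentiable one_ne_zero (y, s)).hasFDerivAt.comp y (hasFDerivAt_prodMk_left y s)

/-- Differentiation under the integral sign over `[0, 1]`. -/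
theorem hasFDerivAt_intervalIntegral_of_contDiff [LocallyCompactSpace E] {G : E × ℝ → F}
    (hG : ContDiff ℝ 1 G) (x : E) :
    HasFDerivAt (fun y => ∫ s in (0 : ℝ)..1, G (y, s))
      (∫ s in (0 : ℝ)..1, (fderiv ℝ G (x, s)).comp (ContinuousLinearMap.inl ℝ E ℝ)) x := by
  have hc : Continuous fun z : E × ℝ => (fderiv ℝ G z).comp (ContinuousLinearMap.inl ℝ E ℝ) :=
    (hG.continuous_fderiv one_ne_zero).clm_comp continuous_const
  obtain ⟨K, hK, hKx⟩ := exists_compact_mem_nhds x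
  obtain ⟨C, hC⟩ := (hK.prod (isCompact_Icc (a := (0 : ℝ)) (b := 1))).exists_bound_of_continuousOn
    hc.continuousOn
  refine intervalIntegral.hasFDerivAt_integral_of_dominated_of_fderiv_le (𝕜 := ℝ)
    (F := fun y s => G (y, s))
    (F' := fun y s => (fderiv ℝ G (y, s)).comp (ContinuousLinearMap.inl ℝ E ℝ))
    (bound := fun _ => C) hKx (.of_forall fun y => ?_) ?_ ?_ (.of_forall fun s hs y hy => ?_) ?_
    (.of_forall fun s hs y hy => ?_)
  · exact (hG.continuous.comp (by fun_prop : Continuous fun s : ℝ => (y, s))).aestronglyMeasurable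
  · exact (hG.continuous.comp
      (by fun_prop : Continuous fun s : ℝ => (x, s))).intervalIntegrable 0 1
  · exact (hc.comp (by fun_prop : Continuous fun s : ℝ => (x, s))).aestronglyMeasurable
  · rw [Set.uIoc_of_le zero_le_one] at hs
    exact hC (y, s) ⟨hy, hs.1.le, hs.2⟩
  · exact intervalIntegrable_const
  · exact hasFDerivAt_curry_left hG y s

/-- The derivative of the integral is again an integral of the same kind, with values in another
space; hence the induction over all target spaces `F`. -/
theorem contDiff_nat_intervalIntegral [LocallyCompactSpace E] (n : ℕ) :
    ∀ {F : Type u} [NormedAddCommGroup F] [NormedSpace ℝ F] {G : E × ℝ → F}, ContDiff ℝ ∞ G →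
      ContDiff ℝ n (fun y => ∫ s in (0 : ℝ)..1, G (y, s)) := by
  induction n with
  | zero =>
    intro F _ _ G hG
    have h1 := fun x => hasFDerivAt_intervalIntegral_of_contDiff (hG.of_le (by simp)) x
    exact contDiff_zero.2 (continuous_iff_continuousAt.2 fun x => (h1 x).continuousAt)
  | succ n ih =>
    intro F _ _ G hG
    have h1 := fun x => hasFDerivAt_intervalIntegral_of_contDiff (hG.of_le (by simp)) x
    push_cast
    refine contDiff_succ_iff_fderiv.2 ⟨fun x => (h1 x).differentiableAt, by simp, ?_⟩
    rw [funext fun x => (h1 x).fderiv]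
    exact ih (G := fun z => (fderiv ℝ G z).comp (ContinuousLinearMap.inl ℝ E ℝ))
      ((hG.fderiv_right (m := ∞) (by simp)).clm_comp contDiff_const)

/-- The integral over `[0, 1]` of a smooth function depends smoothly on the parameters. -/
theorem contDiff_intervalIntegral [LocallyCompactSpace E] {G : E × ℝ → F} (hG : ContDiff ℝ ∞ G) :
    ContDiff ℝ ∞ (fun y => ∫ s in (0 : ℝ)..1, G (y, s)) :=
  contDiff_infty.2 fun n => contDiff_nat_intervalIntegral n hG

end ParametricIntegral

/-- A function which is smooth on a ball agrees on the concentric ball of half the radius with a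
globally smooth function. -/
theorem exists_contDiff_eventuallyEq_on_ball [FiniteDimensional ℝ E] {F : Type*}
    [NormedAddCommGroup F] [NormedSpace ℝ F] {f : E → F} {c : E} {r : ℝ} (hr : 0 < r)
    (hf : ContDiffOn ℝ ∞ f (Metric.ball c r)) :
    ∃ g : E → F, ContDiff ℝ ∞ g ∧ ∀ y ∈ Metric.ball c (r / 2), g =ᶠ[nhds y] f := by
  let χ : ContDiffBump c := ⟨r / 2, 3 / 4 * r, by linarith, by linarith⟩
  refine ⟨fun y => χ y • f y, contDiff_iff_contDiffAt.2 fun y => ?_, fun y hy => ?_⟩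
  · by_cases hy : y ∈ Metric.ball c r
    · exact χ.contDiffAt.smul (hf.contDiffAt (Metric.isOpen_ball.mem_nhds hy))
    · have hy' : y ∉ tsupport χ := by
        rw [χ.tsupport_eq]
        intro h
        apply hy
        simp only [Metric.mem_closedBall, Metric.mem_ball] at h ⊢
        change dist y c ≤ 3 / 4 * r at h
        linarith
      have h0 : (fun y => χ y • f y) =ᶠ[nhds y] fun _ => 0 := by
        filter_upwards [notMem_tsupport_iff_eventuallyEq.1 hy'] with z hz
        simp [hz]
      exact contDiffAt_const.congr_of_eventuallyEq h0
  · filter_upwards [χ.eventuallyEq_one_of_mem_ball hy] with z hz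
    simp [hz]

/-- The Poincaré lemma for `2`-forms, with the space of covectors replaced by an arbitrary normed
space `W` and the evaluation of covectors at `v` by the linear form `ev v`.

The primitive of `Ω` is `θ_y(v) = ∫₀¹ s Ω_{c + s (y - c)}(y - c, v) ds`, formed after replacing
`Ω` by a globally smooth function, so that `θ` is smooth everywhere. -/
theorem exists_primitive_of_pairing [FiniteDimensional ℝ E] {W : Type u} [NormedAddCommGroup W]
    [NormedSpace ℝ W] [CompleteSpace W] (ev : E → W →L[ℝ] ℝ) {Ω : E → E →L[ℝ] W} {c : E}
    {r : ℝ} (hr : 0 < r) (hΩ : ContDiffOn ℝ ∞ Ω (Metric.ball c r))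
    (halt : ∀ y ∈ Metric.ball c r, ∀ v w, ev w (Ω y v) = - ev v (Ω y w))
    (hclosed : ∀ y ∈ Metric.ball c r, ∀ u v w,
      ev w (fderiv ℝ Ω y u v) - ev w (fderiv ℝ Ω y v u) + ev v (fderiv ℝ Ω y w u) = 0) :
    ∃ θ : E → W, ContDiff ℝ ∞ θ ∧ ∀ y ∈ Metric.ball c (r / 2), ∀ u v,
      ev v (fderiv ℝ θ y u) - ev u (fderiv ℝ θ y v) = ev v (Ω y u) := by
  obtain ⟨Ψ, hΨ, hΨΩ⟩ := exists_contDiff_eventuallyEq_on_ball hr hΩ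
  have hsub : Metric.ball c (r / 2) ⊆ Metric.ball c r := Metric.ball_subset_ball (by linarith)
  let γ : E × ℝ → E := fun z => c + z.2 • (z.1 - c)
  have hγ : ContDiff ℝ ∞ γ := by fun_prop
  let G : E × ℝ → W := fun z => z.2 • Ψ (γ z) (z.1 - c)
  have hG : ContDiff ℝ ∞ G :=
    contDiff_snd.smul ((hΨ.comp hγ).clm_apply (contDiff_fst.sub contDiff_const))
  have hG1 : ContDiff ℝ 1 G := hG.of_le (by simp)
  refine ⟨fun y => ∫ s in (0 : ℝ)..1, G (y, s), contDiff_intervalIntegral hG, fun y hy u v => ?_⟩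
  have hΨd : Differentiable ℝ Ψ := hΨ.differentiable (by simp)
  have hGd : ∀ s u, fderiv ℝ G (y, s) (u, 0)
      = s • (s • fderiv ℝ Ψ (c + s • (y - c)) u (y - c) + Ψ (c + s • (y - c)) u) := by
    intro s u
    have h1 := hasFDerivAt_curry_left hG1 y s
    have h2 : HasFDerivAt (fun y => c + s • (y - c)) (s • ContinuousLinearMap.id ℝ E) y :=
      (((hasFDerivAt_id y).sub_const c).const_smul s).const_add c
    have h3 := ((((hΨd (c + s • (y - c))).hasFDerivAt.comp y h2).clm_apply
      ((hasFDerivAt_id y).sub_const c))).const_smul s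
    have h4 := DFunLike.congr_fun (h1.unique h3) u
    simpa [add_comm] using h4
  have hcont : Continuous fun s : ℝ =>
      (fderiv ℝ G (y, s)).comp (ContinuousLinearMap.inl ℝ E ℝ) :=
    ((hG.continuous_fderiv (by simp)).comp
      (by fun_prop : Continuous fun s : ℝ => (y, s))).clm_comp continuous_const
  have hcont' : ∀ u, Continuous fun s : ℝ => fderiv ℝ G (y, s) (u, 0) := fun u =>
    hcont.clm_apply continuous_const
  have hval : ∀ u v, ev v (fderiv ℝ (fun y => ∫ s in (0 : ℝ)..1, G (y, s)) y u)
      = ∫ s in (0 : ℝ)..1, ev v (fderiv ℝ G (y, s) (u, 0)) := by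
    intro u v
    rw [(hasFDerivAt_intervalIntegral_of_contDiff hG1 y).fderiv,
      ContinuousLinearMap.intervalIntegral_apply (hcont.intervalIntegrable 0 1)]
    exact ((ev v).intervalIntegral_comp_comm ((hcont' u).intervalIntegrable 0 1)).symm
  have hint : ∀ u v, IntervalIntegrable (fun s : ℝ => ev v (fderiv ℝ G (y, s) (u, 0)))
      MeasureTheory.volume 0 1 := fun u v =>
    ((ev v).continuous.comp (hcont' u)).intervalIntegrable 0 1
  rw [hval, hval, ← intervalIntegral.integral_sub (hint u v) (hint v u)]
  -- closedness turns the integrand into the derivative of `s² Ω_{c + s (y - c)}(u, v)`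
  have hder : ∀ s ∈ Set.uIcc (0 : ℝ) 1,
      HasDerivAt (fun s : ℝ => s ^ 2 * ev v (Ψ (c + s • (y - c)) u))
        (ev v (fderiv ℝ G (y, s) (u, 0)) - ev u (fderiv ℝ G (y, s) (v, 0))) s := by
    intro s hs
    rw [Set.uIcc_of_le zero_le_one] at hs
    have hmem : c + s • (y - c) ∈ Metric.ball c (r / 2) := by
      rw [mem_ball_iff_norm] at hy ⊢
      rw [add_sub_cancel_left, norm_smul, Real.norm_of_nonneg hs.1]
      calc s * ‖y - c‖ ≤ 1 * ‖y - c‖ := by gcongr; exact hs.2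
        _ < r / 2 := by simpa using hy
    have h2 : HasDerivAt (fun s : ℝ => c + s • (y - c)) (y - c) s := by
      simpa using ((hasDerivAt_id s).smul_const (y - c)).const_add c
    have h3 : HasDerivAt (fun s : ℝ => ev v (Ψ (c + s • (y - c)) u))
        (ev v (fderiv ℝ Ψ (c + s • (y - c)) (y - c) u)) s := by
      have h5 : HasDerivAt (fun s : ℝ => Ψ (c + s • (y - c)))
          (fderiv ℝ Ψ (c + s • (y - c)) (y - c)) s :=
        (hΨd (c + s • (y - c))).hasFDerivAt.comp_hasDerivAt s h2
      have h6 : HasDerivAt (fun s : ℝ => Ψ (c + s • (y - c)) u)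
          (fderiv ℝ Ψ (c + s • (y - c)) (y - c) u) s := by
        simpa using h5.clm_apply (hasDerivAt_const s u)
      exact (ev v).hasFDerivAt.comp_hasDerivAt s h6
    have h4 := (hasDerivAt_pow 2 s).fun_mul h3
    have hcl := hclosed _ (hsub hmem) (y - c) u v
    have ha := halt _ (hsub hmem) v u
    rw [← (hΨΩ _ hmem).fderiv_eq] at hcl
    rw [← (hΨΩ _ hmem).eq_of_nhds] at ha
    refine h4.congr_deriv ?_
    simp only [hGd, map_smul, map_add, smul_eq_mul, ha]
    push_cast
    linear_combination s ^ 2 * hcl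
  rw [intervalIntegral.integral_eq_sub_of_hasDerivAt hder ((hint u v).sub (hint v u))]
  simp [(hΨΩ y hy).eq_of_nhds]

/-- A closed `2`-form on `ball c r` is exact on the ball of half the radius. -/
theorem exists_primitive_two_form [FiniteDimensional ℝ E] {Ω : E → E →L[ℝ] E →L[ℝ] ℝ} {c : E}
    {r : ℝ} (hr : 0 < r) (hΩ : ContDiffOn ℝ ∞ Ω (Metric.ball c r))
    (halt : ∀ y ∈ Metric.ball c r, ∀ v w, Ω y v w = - Ω y w v)
    (hclosed : ∀ y ∈ Metric.ball c r, ∀ u v w,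
      fderiv ℝ Ω y u v w - fderiv ℝ Ω y v u w + fderiv ℝ Ω y w u v = 0) :
    ∃ θ : E → E →L[ℝ] ℝ, ContDiff ℝ ∞ θ ∧
      ∀ y ∈ Metric.ball c (r / 2), ∀ u v, fderiv ℝ θ y u v - fderiv ℝ θ y v u = Ω y u v :=
  exists_primitive_of_pairing (W := E →L[ℝ] ℝ) (ContinuousLinearMap.apply ℝ ℝ) hr hΩ halt hclosed

end Poincare

/-! ### Fields and forms in a chart -/

section Charts

variable {E : Type*} [NormedAddCommGroup E] [NormedSpace ℝ E]
  {H : Type*} [TopologicalSpace H] {I : ModelWithCorners ℝ E H}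
  {M : Type*} [TopologicalSpace M] [ChartedSpace H M]

variable (I) in
/-- The differential at `y` of the inverse of the preferred chart at `p`. -/
noncomputable def chartDeriv (p : M) (y : E) :
    E →L[ℝ] TangentSpace I ((extChartAt I p).symm y) :=
  mfderiv 𝓘(ℝ, E) I (extChartAt I p).symm y

/-- The vector field `X` in the preferred chart at `p`. -/
noncomputable def fieldRep (p : M) (X : VField I M) (y : E) : E :=
  (chartDeriv I p y).inverse (X ((extChartAt I p).symm y))

/-- The field of covectors `θ` in the preferred chart at `p`. -/
noncomputable def covectorRep (p : M) (θ : CovectorField I M) (y : E) : E →L[ℝ] ℝ :=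
  (θ ((extChartAt I p).symm y)).comp (chartDeriv I p y)

/-- The field of bilinear forms `Ω` in the preferred chart at `p`. -/
noncomputable def bilinRep (p : M) (Ω : BilinField I M) (y : E) : E →L[ℝ] E →L[ℝ] ℝ :=
  (ContinuousLinearMap.precomp ℝ (chartDeriv I p y)).comp
    ((Ω ((extChartAt I p).symm y)).comp (chartDeriv I p y))

/-- The vector field with the constant value `v` in the preferred chart at `p`. -/
noncomputable def constField (p : M) (v : E) : VField I M := fun q =>
  (mfderiv I 𝓘(ℝ, E) (extChartAt I p) q).inverse v

/-- The field of covectors which is `α` in the preferred chart at `p`. -/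
noncomputable def ofCovectorRep (p : M) (α : E → E →L[ℝ] ℝ) : CovectorField I M := fun q =>
  (α (extChartAt I p q)).comp (mfderiv I 𝓘(ℝ, E) (extChartAt I p) q)

theorem bilinRep_apply (p : M) (Ω : BilinField I M) (y v w : E) :
    bilinRep p Ω y v w
      = Ω ((extChartAt I p).symm y) (chartDeriv I p y v) (chartDeriv I p y w) :=
  rfl

variable [I.Boundaryless] [IsManifold I ∞ M] {p : M} {y : E}

theorem contMDiffAt_chart_symm (hy : y ∈ (extChartAt I p).target) :
    ContMDiffAt 𝓘(ℝ, E) I ∞ (extChartAt I p).symm y :=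
  (contMDiffOn_extChartAt_symm p).contMDiffAt ((isOpen_extChartAt_target p).mem_nhds hy)

theorem chartDeriv_isInvertible (hy : y ∈ (extChartAt I p).target) :
    (chartDeriv I p y).IsInvertible := by
  have h := isInvertible_mfderivWithin_extChartAt_symm (I := I) hy
  rwa [I.range_eq_univ, mfderivWithin_univ] at h

theorem mfderiv_chart_chartDeriv (hy : y ∈ (extChartAt I p).target) (v : E) :
    mfderiv I 𝓘(ℝ, E) (extChartAt I p) ((extChartAt I p).symm y) (chartDeriv I p y v) = v := by
  have h := mfderiv_extChartAt_comp_mfderivWithin_extChartAt_symm (I := I) hy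
  rw [I.range_eq_univ, mfderivWithin_univ] at h
  exact DFunLike.congr_fun h v

theorem chartDeriv_fieldRep (hy : y ∈ (extChartAt I p).target) (X : VField I M) :
    chartDeriv I p y (fieldRep p X y) = X ((extChartAt I p).symm y) :=
  (chartDeriv_isInvertible hy).self_apply_inverse _

theorem fieldRep_eq (hy : y ∈ (extChartAt I p).target) (X : VField I M) :
    fieldRep p X y = mfderiv I 𝓘(ℝ, E) (extChartAt I p) ((extChartAt I p).symm y)
      (X ((extChartAt I p).symm y)) := by
  rw [← chartDeriv_fieldRep hy X]
  exact (mfderiv_chart_chartDeriv hy _).symm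

theorem covectorRep_fieldRep (hy : y ∈ (extChartAt I p).target) (θ : CovectorField I M)
    (X : VField I M) :
    covectorRep p θ y (fieldRep p X y)
      = θ ((extChartAt I p).symm y) (X ((extChartAt I p).symm y)) :=
  congrArg (θ ((extChartAt I p).symm y)) (chartDeriv_fieldRep hy X)

theorem bilinRep_fieldRep (hy : y ∈ (extChartAt I p).target) (Ω : BilinField I M)
    (X Z : VField I M) :
    bilinRep p Ω y (fieldRep p X y) (fieldRep p Z y)
      = Ω ((extChartAt I p).symm y) (X ((extChartAt I p).symm y))
          (Z ((extChartAt I p).symm y)) := by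
  rw [bilinRep_apply, chartDeriv_fieldRep hy, chartDeriv_fieldRep hy]

theorem fieldRep_constField (hy : y ∈ (extChartAt I p).target) (v : E) :
    fieldRep p (constField (I := I) p v) y = v := by
  have hi := isInvertible_mfderiv_extChartAt (I := I) ((extChartAt I p).map_target hy)
  rw [fieldRep_eq hy]
  exact hi.self_apply_inverse v

theorem covectorRep_ofCovectorRep (hy : y ∈ (extChartAt I p).target) (α : E → E →L[ℝ] ℝ) :
    covectorRep p (ofCovectorRep (I := I) p α) y = α y := by
  ext v
  change α (extChartAt I p ((extChartAt I p).symm y)) (mfderiv I 𝓘(ℝ, E) (extChartAt I p)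
    ((extChartAt I p).symm y) (chartDeriv I p y v)) = α y v
  rw [(extChartAt I p).right_inv hy]
  exact congrArg (α y) (mfderiv_chart_chartDeriv hy v)

theorem SmoothFieldAt.contDiffAt_fieldRep [CompleteSpace E] {X : VField I M}
    (hy : y ∈ (extChartAt I p).target) (hX : SmoothFieldAt X ((extChartAt I p).symm y)) :
    ContDiffAt ℝ ∞ (fieldRep p X) y := by
  have hi : (mfderiv 𝓘(ℝ, E) I (extChartAt I p).symm y).IsInvertible :=
    chartDeriv_isInvertible (E := E) hy
  have h := ContMDiffAt.mpullback_vectorField_preimage (n := ∞) (m := ∞) hX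
    (contMDiffAt_chart_symm hy) hi (by simp)
  have h' := (contMDiffAt_vectorSpace_iff_contDiffAt (𝕜 := ℝ) (E := E) (n := ∞) (x := y)
    (V := VectorField.mpullback 𝓘(ℝ, E) I (extChartAt I p).symm X)).1 h
  exact h'

omit [I.Boundaryless] in
theorem smoothFieldAt_constField [CompleteSpace E] {q : M} (hq : q ∈ (extChartAt I p).source)
    (v : E) : SmoothFieldAt (constField (I := I) p v) q := by
  have hv : ContMDiffAt 𝓘(ℝ, E) 𝓘(ℝ, E).tangent ∞
      (fun y => (⟨y, v⟩ : TangentBundle 𝓘(ℝ, E) E)) (extChartAt I p q) :=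
    contMDiffAt_vectorSpace_iff_contDiffAt.2 contDiffAt_const
  rw [extChartAt_source] at hq
  exact ContMDiffAt.mpullback_vectorField_preimage (n := ∞) (m := ∞) hv
    (contMDiffAt_extChartAt' hq) (isInvertible_mfderiv_extChartAt (by rwa [extChartAt_source]))
    (by simp)

/-- The Lie bracket computed in a chart. -/
theorem fieldRep_bracket [CompleteSpace E] {X Z : VField I M} (hy : y ∈ (extChartAt I p).target)
    (hX : SmoothFieldAt X ((extChartAt I p).symm y))
    (hZ : SmoothFieldAt Z ((extChartAt I p).symm y)) :
    fieldRep p (bracket X Z) y = fderiv ℝ (fieldRep p Z) y (fieldRep p X y)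
      - fderiv ℝ (fieldRep p X) y (fieldRep p Z y) := by
  have : IsManifold I (minSmoothness ℝ 2) M := by
    rw [minSmoothness_of_isRCLikeNormedField]
    infer_instance
  have h := VectorField.mpullback_mlieBracket (n := ∞) (hX.mdifferentiableAt (by simp))
    (hZ.mdifferentiableAt (by simp)) (contMDiffAt_chart_symm hy) (by
      rw [minSmoothness_of_isRCLikeNormedField]
      exact WithTop.coe_le_coe.2 le_top)
  rw [← VectorField.mlieBracketWithin_univ (I := 𝓘(ℝ, E)),
    VectorField.mlieBracketWithin_eq_lieBracketWithin] at h
  refine Eq.trans h (congrFun (VectorField.lieBracketWithin_univ (𝕜 := ℝ)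
    (V := fieldRep p X) (W := fieldRep p Z)) y)

/-- A directional derivative computed in a chart. -/
theorem dirDeriv_eq_fderiv (hy : y ∈ (extChartAt I p).target) {f : M → ℝ} {g : E → ℝ}
    (hg : DifferentiableAt ℝ g y)
    (hfg : ∀ z ∈ (extChartAt I p).target, f ((extChartAt I p).symm z) = g z) (X : VField I M) :
    dirDeriv X f ((extChartAt I p).symm y) = fderiv ℝ g y (fieldRep p X y) := by
  have hs := (extChartAt I p).map_target hy
  have hev : f =ᶠ[nhds ((extChartAt I p).symm y)] g ∘ extChartAt I p := by
    filter_upwards [(isOpen_extChartAt_source p).mem_nhds hs] with q hq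
    rw [Function.comp_apply, ← hfg _ ((extChartAt I p).map_source hq),
      (extChartAt I p).left_inv hq]
  have he : MDifferentiableAt I 𝓘(ℝ, E) (extChartAt I p) ((extChartAt I p).symm y) :=
    mdifferentiableAt_extChartAt (by rwa [← extChartAt_source (I := I)])
  have hg' : HasFDerivAt g (fderiv ℝ g y) (extChartAt I p ((extChartAt I p).symm y)) := by
    rw [(extChartAt I p).right_inv hy]
    exact hg.hasFDerivAt
  have h := (hg'.hasMFDerivAt.comp _ he.hasMFDerivAt).congr_of_eventuallyEq hev
  rw [fieldRep_eq hy]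
  change mfderiv I 𝓘(ℝ, ℝ) f _ _ = _
  rw [h.mfderiv]
  rfl

end Charts

/-! ### Exterior and Lie derivatives in a chart -/

section ChartDerivatives

variable {E : Type*} [NormedAddCommGroup E] [NormedSpace ℝ E] [CompleteSpace E]
  {H : Type*} [TopologicalSpace H] {I : ModelWithCorners ℝ E H}
  {M : Type*} [TopologicalSpace M] [ChartedSpace H M] [I.Boundaryless] [IsManifold I ∞ M]
  {p : M} {y : E}

omit [CompleteSpace E] in
theorem fderiv_bilin_apply {β : E → E →L[ℝ] E →L[ℝ] ℝ} (hβ : DifferentiableAt ℝ β y)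
    (u v w : E) : fderiv ℝ β y u v w = fderiv ℝ (fun z => β z v w) y u := by
  rw [fderiv_clm_apply (hβ.clm_apply (differentiableAt_const v)) (differentiableAt_const w),
    fderiv_clm_apply hβ (differentiableAt_const v)]
  simp

theorem extDerivOne_chart (hy : y ∈ (extChartAt I p).target) {θ : CovectorField I M}
    (hθ : DifferentiableAt ℝ (covectorRep p θ) y) {X Z : VField I M}
    (hX : SmoothFieldAt X ((extChartAt I p).symm y))
    (hZ : SmoothFieldAt Z ((extChartAt I p).symm y)) :
    extDerivOne θ X Z ((extChartAt I p).symm y)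
      = fderiv ℝ (covectorRep p θ) y (fieldRep p X y) (fieldRep p Z y)
        - fderiv ℝ (covectorRep p θ) y (fieldRep p Z y) (fieldRep p X y) := by
  have hX' := (hX.contDiffAt_fieldRep hy).differentiableAt (by simp)
  have hZ' := (hZ.contDiffAt_fieldRep hy).differentiableAt (by simp)
  have hd : ∀ {W : VField I M}, DifferentiableAt ℝ (fieldRep p W) y → ∀ V : VField I M,
      dirDeriv V (fun q => θ q (W q)) ((extChartAt I p).symm y)
        = fderiv ℝ (covectorRep p θ) y (fieldRep p V y) (fieldRep p W y)
          + covectorRep p θ y (fderiv ℝ (fieldRep p W) y (fieldRep p V y)) := by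
    intro W hW V
    rw [dirDeriv_eq_fderiv hy (hθ.clm_apply hW)
      (fun z hz => (covectorRep_fieldRep hz θ W).symm) V, fderiv_clm_apply hθ hW]
    simp [add_comm]
  rw [extDerivOne, hd hX', hd hZ', ← covectorRep_fieldRep hy, fieldRep_bracket hy hX hZ, map_sub]
  ring

omit [CompleteSpace E] in
/-- A constant field has a constant representative in its own chart, hence zero derivative. -/
theorem fderiv_fieldRep_constField (hy : y ∈ (extChartAt I p).target) (v : E) :
    fderiv ℝ (fieldRep p (constField (I := I) p v)) y = 0 := by
  have h : fieldRep p (constField (I := I) p v) =ᶠ[nhds y] fun _ => v := by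
    filter_upwards [(isOpen_extChartAt_target p).mem_nhds hy] with z hz
    exact fieldRep_constField hz v
  rw [h.fderiv_eq, fderiv_fun_const]
  rfl

omit [I.Boundaryless] in
theorem smoothFieldAt_constField_symm (hy : y ∈ (extChartAt I p).target) (v : E) :
    SmoothFieldAt (constField (I := I) p v) ((extChartAt I p).symm y) :=
  smoothFieldAt_constField ((extChartAt I p).map_target hy) v

theorem bracket_constField (hy : y ∈ (extChartAt I p).target) (v w : E) :
    bracket (constField (I := I) p v) (constField p w) ((extChartAt I p).symm y) = 0 := by
  rw [← chartDeriv_fieldRep hy (bracket (constField p v) (constField p w)),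
    fieldRep_bracket hy (smoothFieldAt_constField_symm hy v)
      (smoothFieldAt_constField_symm hy w), fderiv_fieldRep_constField hy,
    fderiv_fieldRep_constField hy, zero_apply, zero_apply, sub_zero]
  exact map_zero (chartDeriv I p y)

omit [CompleteSpace E] in
theorem bilinField_constField (hy : y ∈ (extChartAt I p).target) (Ω : BilinField I M) (v w : E) :
    Ω ((extChartAt I p).symm y) (constField p v ((extChartAt I p).symm y))
      (constField p w ((extChartAt I p).symm y)) = bilinRep p Ω y v w := by
  rw [← bilinRep_fieldRep hy, fieldRep_constField hy, fieldRep_constField hy]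

omit [CompleteSpace E] in
theorem dirDeriv_bilinField_constField (hy : y ∈ (extChartAt I p).target) {Ω : BilinField I M}
    (hΩ : DifferentiableAt ℝ (bilinRep p Ω) y) (X : VField I M) (v w : E) :
    dirDeriv X (fun q => Ω q (constField p v q) (constField p w q)) ((extChartAt I p).symm y)
      = fderiv ℝ (bilinRep p Ω) y (fieldRep p X y) v w := by
  rw [fderiv_bilin_apply hΩ]
  exact dirDeriv_eq_fderiv hy
    ((hΩ.clm_apply (differentiableAt_const v)).clm_apply (differentiableAt_const w))
    (fun z hz => bilinField_constField hz Ω v w) X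

/-- A closed `2`-form is closed in every chart. -/
theorem IsClosedTwoForm.bilinRep_closed {Ω : BilinField I M} (h : IsClosedTwoForm Ω)
    (hy : y ∈ (extChartAt I p).target) (hΩ : DifferentiableAt ℝ (bilinRep p Ω) y) (u v w : E) :
    fderiv ℝ (bilinRep p Ω) y u v w - fderiv ℝ (bilinRep p Ω) y v u w
      + fderiv ℝ (bilinRep p Ω) y w u v = 0 := by
  have h1 := h ((extChartAt I p).symm y) (constField p u) (constField p v) (constField p w)
    (smoothFieldAt_constField_symm hy u) (smoothFieldAt_constField_symm hy v)
    (smoothFieldAt_constField_symm hy w)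
  rw [extDerivTwo, dirDeriv_bilinField_constField hy hΩ, dirDeriv_bilinField_constField hy hΩ,
    dirDeriv_bilinField_constField hy hΩ, bracket_constField hy, bracket_constField hy,
    bracket_constField hy, fieldRep_constField hy, fieldRep_constField hy,
    fieldRep_constField hy] at h1
  have hz : ∀ a, Ω ((extChartAt I p).symm y) 0 a = 0 := fun a =>
    DFunLike.congr_fun (map_zero (Ω ((extChartAt I p).symm y))) a
  rw [hz, hz, hz] at h1
  linarith

/-- The equation `L(Y)Ω = 0` in a chart. -/
theorem LieDerivTwoEqZero.bilinRep_eq_zero {Ω : BilinField I M} {Y : VField I M}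
    (h : LieDerivTwoEqZero Y Ω) (hy : y ∈ (extChartAt I p).target)
    (hY : SmoothFieldAt Y ((extChartAt I p).symm y))
    (hΩ : DifferentiableAt ℝ (bilinRep p Ω) y) (v w : E) :
    fderiv ℝ (bilinRep p Ω) y (fieldRep p Y y) v w
      + bilinRep p Ω y (fderiv ℝ (fieldRep p Y) y v) w
      + bilinRep p Ω y v (fderiv ℝ (fieldRep p Y) y w) = 0 := by
  have h1 := h ((extChartAt I p).symm y) (constField p v) (constField p w)
    (smoothFieldAt_constField_symm hy v) (smoothFieldAt_constField_symm hy w)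
  have hb : ∀ v, fieldRep p (bracket Y (constField p v)) y = - fderiv ℝ (fieldRep p Y) y v := by
    intro v
    rw [fieldRep_bracket hy hY (smoothFieldAt_constField_symm hy v),
      fderiv_fieldRep_constField hy, fieldRep_constField hy]
    simp
  rw [lieDerivTwo, dirDeriv_bilinField_constField hy hΩ, ← bilinRep_fieldRep hy,
    ← bilinRep_fieldRep hy, hb, hb, fieldRep_constField hy, fieldRep_constField hy] at h1
  simp only [map_neg, neg_apply, sub_neg_eq_add] at h1
  exact h1

/-- A smooth `2`-form is smooth in every chart. -/
theorem IsTwoForm.contDiffOn_bilinRep [FiniteDimensional ℝ E] {Ω : BilinField I M}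
    (h : IsTwoForm Ω) (p : M) : ContDiffOn ℝ ∞ (bilinRep p Ω) (extChartAt I p).target := by
  refine contDiffOn_clm_apply.2 fun v => contDiffOn_clm_apply.2 fun w => ?_
  have h1 : ∀ y ∈ (extChartAt I p).target, ContMDiffAt I 𝓘(ℝ, ℝ) ∞
      (fun q => Ω q (constField p v q) (constField p w q)) ((extChartAt I p).symm y) := by
    intro y hy
    have h2 := ContMDiffAt.clm_bundle_apply₂ (F₃ := ℝ) (E₃ := fun _ : M => ℝ)
      (h.2 ((extChartAt I p).symm y)) (smoothFieldAt_constField_symm hy v)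
      (smoothFieldAt_constField_symm hy w)
    rw [contMDiffAt_totalSpace] at h2
    exact h2.2
  intro y hy
  have h3 := ((h1 y hy).comp y (contMDiffAt_chart_symm hy)).contDiffAt
  refine (h3.congr_of_eventuallyEq ?_).contDiffWithinAt
  filter_upwards [(isOpen_extChartAt_target p).mem_nhds hy] with z hz
  exact (bilinField_constField hz Ω v w).symm

omit [CompleteSpace E] [I.Boundaryless] in
/-- A field of covectors with a smooth representative in a chart is a smooth `1`-form there. -/
theorem isOneFormOn_ofCovectorRep (p : M) {α : E → E →L[ℝ] ℝ} (hα : ContDiff ℝ ∞ α)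
    {U : Set M} (hU : U ⊆ (extChartAt I p).source) :
    IsOneFormOn (ofCovectorRep (I := I) p α) U := by
  intro q hq
  have hq' := hU hq
  rw [extChartAt_source] at hq'
  have he : ContMDiffAt I 𝓘(ℝ, E) ∞ (extChartAt I p) q := contMDiffAt_extChartAt' hq'
  refine ContMDiffAt.contMDiffWithinAt ?_
  rw [contMDiffAt_hom_bundle]
  refine ⟨contMDiffAt_id, ?_⟩
  have h1 := he.mfderiv_const (m := ∞) (by simp)
  have h2 : ContMDiffAt I 𝓘(ℝ, E →L[ℝ] ℝ) ∞ (fun q => α (extChartAt I p q)) q :=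
    hα.contMDiff.contMDiffAt.comp q he
  refine (h2.clm_comp h1).congr_of_eventuallyEq (.of_forall fun z => ?_)
  change ContinuousLinearMap.inCoordinates _ _ _ _ _ _ _ _ _ = ContinuousLinearMap.comp _
    (ContinuousLinearMap.inCoordinates _ _ _ _ _ _ _ _ _)
  rw [ContinuousLinearMap.inCoordinates, ContinuousLinearMap.inCoordinates]
  ext v
  simp only [Trivial.fiberBundle_trivializationAt', Trivial.continuousLinearMapAt_trivialization,
    ContinuousLinearMap.id_comp, ContinuousLinearMap.comp_apply,
    TangentBundle.continuousLinearMapAt_model_space]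
  rfl

end ChartDerivatives

/-! ### Local potentials and local Hamiltonian functions -/

section LocalPrimitives

variable {E : Type*} [NormedAddCommGroup E] [NormedSpace ℝ E]
  {H : Type*} [TopologicalSpace H] {I : ModelWithCorners ℝ E H}
  {M : Type*} [TopologicalSpace M] [ChartedSpace H M]

variable (I) in
/-- The points of the preferred chart at `p` whose coordinates lie in a ball around those
of `p`. -/
def chartBall (p : M) (r : ℝ) : Set M :=
  (extChartAt I p).source ∩ extChartAt I p ⁻¹' Metric.ball (extChartAt I p p) r

theorem isOpen_chartBall (p : M) (r : ℝ) : IsOpen (chartBall I p r) :=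
  (continuousOn_extChartAt p).isOpen_inter_preimage (isOpen_extChartAt_source p)
    Metric.isOpen_ball

theorem mem_chartBall_self (p : M) {r : ℝ} (hr : 0 < r) : p ∈ chartBall I p r :=
  ⟨mem_extChartAt_source p, Metric.mem_ball_self hr⟩

theorem IsOneFormOn.contMDiffWithinAt_apply [IsManifold I ∞ M] {θ : CovectorField I M}
    {U : Set M} (hθ : IsOneFormOn θ U) {X : VField I M} {q : M} (hX : SmoothFieldAt X q)
    (hq : q ∈ U) :
    ContMDiffWithinAt I 𝓘(ℝ, ℝ) ∞ (fun q => θ q (X q)) U q := by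
  have h := ContMDiffWithinAt.clm_bundle_apply (F₂ := ℝ) (E₂ := fun _ : M => ℝ) (hθ q hq)
    hX.contMDiffWithinAt
  rw [contMDiffWithinAt_totalSpace] at h
  exact h.2

variable [CompleteSpace E] [I.Boundaryless] [IsManifold I ∞ M] {p : M}

/-- A `2`-form which is closed in a chart has a potential on balls of the chart. The radius is
halved to leave room for the cutoff in the Poincaré lemma. -/
theorem exists_potential_chartBall [FiniteDimensional ℝ E] {Ω : BilinField I M} {r : ℝ} (hr : 0 < r)
    (hball : Metric.ball (extChartAt I p p) r ⊆ (extChartAt I p).target)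
    (hΩ : ContDiffOn ℝ ∞ (bilinRep p Ω) (extChartAt I p).target)
    (halt : ∀ q v w, Ω q v w = - Ω q w v)
    (hclosed : ∀ y ∈ (extChartAt I p).target, ∀ u v w,
      fderiv ℝ (bilinRep p Ω) y u v w - fderiv ℝ (bilinRep p Ω) y v u w
        + fderiv ℝ (bilinRep p Ω) y w u v = 0) :
    ∃ θ, IsOneFormOn θ (chartBall I p (r / 2)) ∧
      EqNegExtDerivOn Ω θ (chartBall I p (r / 2)) := by
  obtain ⟨α, hα, hdα⟩ := exists_primitive_two_form hr (hΩ.mono hball)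
    (fun y _ v w => halt _ _ _) (fun y hy => hclosed y (hball hy))
  refine ⟨ofCovectorRep p (fun y => - α y),
    isOneFormOn_ofCovectorRep p hα.neg Set.inter_subset_left, ?_⟩
  rintro q ⟨hq, hqr⟩ X Z hX hZ
  obtain ⟨y, hy, rfl⟩ : ∃ y ∈ (extChartAt I p).target, (extChartAt I p).symm y = q :=
    ⟨_, (extChartAt I p).map_source hq, (extChartAt I p).left_inv hq⟩
  rw [Set.mem_preimage, (extChartAt I p).right_inv hy] at hqr
  have hrep : covectorRep p (ofCovectorRep (I := I) p fun y => - α y)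
      =ᶠ[nhds y] fun y => - α y := by
    filter_upwards [(isOpen_extChartAt_target p).mem_nhds hy] with z hz
    exact covectorRep_ofCovectorRep hz _
  have hd : DifferentiableAt ℝ (fun y => - α y) y := hα.neg.differentiable (by simp) y
  rw [extDerivOne_chart hy (hd.congr_of_eventuallyEq hrep) hX hZ, hrep.fderiv_eq, fderiv_fun_neg,
    ← bilinRep_fieldRep hy, ← hdα y hqr]
  simp only [neg_apply]
  ring

/-- If `Ω` is closed and `L(Y)Ω = 0` in a chart, then `i(Y)Ω` is closed, and hence exact on
balls of the chart. -/
theorem exists_hamiltonian_chartBall {Ω : BilinField I M} {r : ℝ}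
    (hball : Metric.ball (extChartAt I p p) r ⊆ (extChartAt I p).target)
    (hΩ : ContDiffOn ℝ ∞ (bilinRep p Ω) (extChartAt I p).target)
    (halt : ∀ q v w, Ω q v w = - Ω q w v)
    (hclosed : ∀ y ∈ (extChartAt I p).target, ∀ u v w,
      fderiv ℝ (bilinRep p Ω) y u v w - fderiv ℝ (bilinRep p Ω) y v u w
        + fderiv ℝ (bilinRep p Ω) y w u v = 0)
    {Y : VField I M} (hY : SmoothField Y) (hL : LieDerivTwoEqZero Y Ω) :
    ∃ f : M → ℝ, ContMDiffOn I 𝓘(ℝ, ℝ) ∞ f (chartBall I p r) ∧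
      ∀ q ∈ chartBall I p r, ∀ X : VField I M, dirDeriv X f q = Ω q (Y q) (X q) := by
  let B := Metric.ball (extChartAt I p p) r
  have hopen : IsOpen B := Metric.isOpen_ball
  have hYs : ∀ y ∈ B, ContDiffAt ℝ ∞ (fieldRep p Y) y := fun y hy =>
    SmoothFieldAt.contDiffAt_fieldRep (hball hy) (hY _)
  have hβ : ContDiffOn ℝ ∞ (fun y => bilinRep p Ω y (fieldRep p Y y)) B :=
    (hΩ.mono hball).clm_apply fun y hy => (hYs y hy).contDiffWithinAt
  have hΩd : ∀ y ∈ B, DifferentiableAt ℝ (bilinRep p Ω) y := fun y hy =>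
    (hΩ.contDiffAt ((isOpen_extChartAt_target p).mem_nhds (hball hy))).differentiableAt (by simp)
  obtain ⟨g, hg⟩ := (convex_ball (extChartAt I p p) r).exists_forall_hasFDerivAt_of_fderiv_symmetric
    hopen (hβ.differentiableOn (by simp)) (by
      intro y hy u v
      have hYd := (hYs y hy).differentiableAt (by simp)
      have h1 := hclosed y (hball hy) (fieldRep p Y y) u v
      have h2 := hL.bilinRep_eq_zero (hball hy) (hY _) (hΩd y hy) u v
      have h3 : bilinRep p Ω y u (fderiv ℝ (fieldRep p Y) y v)
          = - bilinRep p Ω y (fderiv ℝ (fieldRep p Y) y v) u := halt _ _ _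
      rw [fderiv_clm_apply (hΩd y hy) hYd]
      simp only [add_apply, ContinuousLinearMap.comp_apply, ContinuousLinearMap.flip_apply]
      linarith)
  have hgs : ContDiffOn ℝ ∞ g B := by
    refine (contDiffOn_infty_iff_fderiv_of_isOpen hopen).2
      ⟨fun y hy => (hg y hy).differentiableAt.differentiableWithinAt, ?_⟩
    exact hβ.congr fun y hy => (hg y hy).fderiv
  refine ⟨g ∘ extChartAt I p, ?_, ?_⟩
  · refine hgs.contMDiffOn.comp ((contMDiffOn_extChartAt (x := p)).mono ?_) fun q hq => hq.2
    exact Set.inter_subset_left.trans (extChartAt_source (I := I) p).le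
  · rintro q ⟨hq, hqr⟩ X
    obtain ⟨y, hy, rfl⟩ : ∃ y ∈ (extChartAt I p).target, (extChartAt I p).symm y = q :=
      ⟨_, (extChartAt I p).map_source hq, (extChartAt I p).left_inv hq⟩
    rw [Set.mem_preimage, (extChartAt I p).right_inv hy] at hqr
    rw [dirDeriv_eq_fderiv hy (hg y hqr).differentiableAt
      (fun z hz => congrArg g ((extChartAt I p).right_inv hz)) X, (hg y hqr).fderiv,
      bilinRep_fieldRep hy]

end LocalPrimitives

/-! ### Potentials, Lie primitives and Hamiltonian functions -/

section NoetherIdentities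

variable {E : Type*} [NormedAddCommGroup E] [NormedSpace ℝ E]
  {H : Type*} [TopologicalSpace H] {I : ModelWithCorners ℝ E H}
  {M : Type*} [TopologicalSpace M] [ChartedSpace H M] [IsManifold I ∞ M]
  {U : Set M} {Ω : BilinField I M} {θ : CovectorField I M} {Y : VField I M}

/-- Cartan's formula `L(Y)θ = i(Y)dθ + d(i(Y)θ)` for a potential `θ` of `Ω`. -/
theorem EqNegExtDerivOn.lieDerivOne_eq (h : EqNegExtDerivOn Ω θ U) (hY : SmoothField Y) {q : M}
    (hq : q ∈ U) {X : VField I M} (hX : SmoothFieldAt X q) :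
    lieDerivOne Y θ X q = dirDeriv X (fun q => θ q (Y q)) q - Ω q (Y q) (X q) := by
  rw [h q hq Y X (hY q) hX, extDerivOne, lieDerivOne]
  ring

/-- If `i(Y)Ω = df` and `θ` is a potential of `Ω`, then `L(Y)θ = d(i(Y)θ - f)`. -/
theorem EqNegExtDerivOn.lieDerivOneEqDiffOn (h : EqNegExtDerivOn Ω θ U) (hU : IsOpen U)
    (hθ : IsOneFormOn θ U) (hY : SmoothField Y) {f : M → ℝ}
    (hf : ContMDiffOn I 𝓘(ℝ, ℝ) ∞ f U)
    (hdf : ∀ q ∈ U, ∀ X : VField I M, dirDeriv X f q = Ω q (Y q) (X q)) :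
    LieDerivOneEqDiffOn Y θ (fun q => θ q (Y q) - f q) U := by
  intro q hq X hX
  have h1 := ((hθ.contMDiffWithinAt_apply (hY q) hq).contMDiffAt
    (hU.mem_nhds hq)).mdifferentiableAt (by simp)
  have h2 := (hf.contMDiffAt (hU.mem_nhds hq)).mdifferentiableAt (by simp)
  rw [h.lieDerivOne_eq hY hq hX, ← hdf q hq X]
  exact (DFunLike.congr_fun (mvfderiv_sub h1 h2) (X q)).symm

/-- If `θ` is a potential of `Ω` and `L(Y)θ = dζ`, then `i(Y)Ω = d(i(Y)θ - ζ)`. -/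
theorem LieDerivOneEqDiffOn.bilin_eq_mvfderiv [CompleteSpace E] (hU : IsOpen U)
    (hθ : IsOneFormOn θ U)
    (h : EqNegExtDerivOn Ω θ U) (hY : SmoothField Y) {ζ : M → ℝ}
    (hζ : ContMDiffOn I 𝓘(ℝ, ℝ) ∞ ζ U) (hL : LieDerivOneEqDiffOn Y θ ζ U) {q : M} (hq : q ∈ U)
    (v : TangentSpace I q) :
    Ω q (Y q) v = mvfderiv I (fun q => θ q (Y q) - ζ q) q v := by
  obtain ⟨X, hX, rfl⟩ : ∃ X : VField I M, SmoothFieldAt X q ∧ X q = v := by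
    refine ⟨constField q (mfderiv I 𝓘(ℝ, E) (extChartAt I q) q v),
      smoothFieldAt_constField (mem_extChartAt_source q) _, ?_⟩
    exact (isInvertible_mfderiv_extChartAt (mem_extChartAt_source q)).inverse_apply_self v
  have h1 := ((hθ.contMDiffWithinAt_apply (hY q) hq).contMDiffAt
    (hU.mem_nhds hq)).mdifferentiableAt (by simp)
  have h2 := (hζ.contMDiffAt (hU.mem_nhds hq)).mdifferentiableAt (by simp)
  have h3 := hL q hq X hX
  rw [h.lieDerivOne_eq hY hq hX] at h3
  refine Eq.trans ?_ (DFunLike.congr_fun (mvfderiv_sub h1 h2) (X q)).symm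
  change _ = mvfderiv I (fun q => θ q (Y q)) q (X q) - mvfderiv I ζ q (X q)
  rw [← h3, dirDeriv]
  ring

end NoetherIdentities

/-! ### The forms `ω^A` on `ℝ^k × M` -/

section Omega

variable {k n : ℕ} {M : Type*} [TopologicalSpace M]
  [ChartedSpace (EuclideanSpace ℝ (Fin (n + k * n))) M]
  [IsManifold (𝓡 (n + k * n)) ∞ M] {p : Rk k × M}

omit [IsManifold (𝓡 (n + k * n)) ∞ M] in
theorem snd_mem_chart_target {z : Rk k × EuclideanSpace ℝ (Fin (n + k * n))}
    (hz : z ∈ (extChartAt (prodModel k n) p).target) :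
    z.2 ∈ (extChartAt (𝓡 (n + k * n)) p.2).target := by
  rw [extChartAt_prod] at hz
  exact hz.2

theorem IsTwoForm.swap {N : Type*} {E : Type*} [NormedAddCommGroup E] [NormedSpace ℝ E]
    {H : Type*} [TopologicalSpace H] {I : ModelWithCorners ℝ E H} [TopologicalSpace N]
    [ChartedSpace H N] [IsManifold I ∞ N] {Ω : BilinField I N} (h : IsTwoForm Ω) (q : N)
    (v w : TangentSpace I q) : Ω q v w = - Ω q w v := by
  have h1 := h.1 q (v + w)
  simp only [map_add, add_apply, h.1, zero_add, add_zero] at h1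
  linarith

theorem omega_swap (S : KSymplecticStructure k n M) (A : Fin k) (q : Rk k × M)
    (v w : TangentSpace (prodModel k n) q) : omega S A q v w = - omega S A q w v :=
  (S.isTwoForm A).swap q.2 _ _

/-- In product charts, `ω^A` is the pullback of `ω₀^A` along the projection. -/
theorem bilinRep_omega (S : KSymplecticStructure k n M) (A : Fin k)
    {z : Rk k × EuclideanSpace ℝ (Fin (n + k * n))}
    (hz : z ∈ (extChartAt (prodModel k n) p).target)
    (v w : Rk k × EuclideanSpace ℝ (Fin (n + k * n))) :
    bilinRep p (omega S A) z v w = bilinRep p.2 (S.form A) z.2 v.2 w.2 := by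
  have hD : ∀ u : Rk k × EuclideanSpace ℝ (Fin (n + k * n)),
      mfderiv (prodModel k n) (𝓡 (n + k * n)) (Prod.snd : Rk k × M → M)
        ((extChartAt (prodModel k n) p).symm z) (chartDeriv (prodModel k n) p z u)
        = chartDeriv (𝓡 (n + k * n)) p.2 z.2 u.2 := by
    intro u
    have h1 := (contMDiffAt_chart_symm hz).mdifferentiableAt (by simp)
    have h2 := mfderiv_comp_apply z (mdifferentiableAt_snd (I := 𝓡 k) (I' := 𝓡 (n + k * n))) h1 u
    have h3 : Prod.snd ∘ (extChartAt (prodModel k n) p).symm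
        = (extChartAt (𝓡 (n + k * n)) p.2).symm ∘ Prod.snd := by
      rw [extChartAt_prod]
      rfl
    have h4 : MDifferentiableAt 𝓘(ℝ, EuclideanSpace ℝ (Fin (n + k * n))) (𝓡 (n + k * n))
        (extChartAt (𝓡 (n + k * n)) p.2).symm z.2 :=
      (contMDiffAt_chart_symm (snd_mem_chart_target hz)).mdifferentiableAt (by simp)
    have h5 : HasMFDerivAt 𝓘(ℝ, Rk k × EuclideanSpace ℝ (Fin (n + k * n)))
        𝓘(ℝ, EuclideanSpace ℝ (Fin (n + k * n)))
        (Prod.snd : Rk k × EuclideanSpace ℝ (Fin (n + k * n)) → _) z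
        (ContinuousLinearMap.snd ℝ (Rk k) (EuclideanSpace ℝ (Fin (n + k * n)))) :=
      hasFDerivAt_snd.hasMFDerivAt
    have h6 := h4.hasMFDerivAt.comp z h5
    rw [h3] at h2
    exact h2.symm.trans (congrArg (fun L => L u) h6.mfderiv)
  rw [bilinRep_apply, omega_apply, hD, hD]
  rfl

theorem contDiffOn_bilinRep_omega (S : KSymplecticStructure k n M) (A : Fin k) :
    ContDiffOn ℝ ∞ (bilinRep p (omega S A)) (extChartAt (prodModel k n) p).target := by
  refine contDiffOn_clm_apply.2 fun v => contDiffOn_clm_apply.2 fun w => ?_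
  have h1 := contDiffOn_clm_apply.1
    (contDiffOn_clm_apply.1 ((S.isTwoForm A).contDiffOn_bilinRep p.2) v.2) w.2
  exact (h1.comp contDiff_snd.contDiffOn fun z hz => snd_mem_chart_target hz).congr
    fun z hz => bilinRep_omega S A hz v w

theorem bilinRep_omega_closed (S : KSymplecticStructure k n M) (A : Fin k)
    {z : Rk k × EuclideanSpace ℝ (Fin (n + k * n))}
    (hz : z ∈ (extChartAt (prodModel k n) p).target)
    (u v w : Rk k × EuclideanSpace ℝ (Fin (n + k * n))) :
    fderiv ℝ (bilinRep p (omega S A)) z u v w - fderiv ℝ (bilinRep p (omega S A)) z v u w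
      + fderiv ℝ (bilinRep p (omega S A)) z w u v = 0 := by
  have hz2 := snd_mem_chart_target hz
  have hnhds := (isOpen_extChartAt_target (I := prodModel k n) p).mem_nhds hz
  have h1 : DifferentiableAt ℝ (bilinRep p (omega S A)) z :=
    ((contDiffOn_bilinRep_omega S A).contDiffAt hnhds).differentiableAt (by simp)
  have h2 : DifferentiableAt ℝ (bilinRep p.2 (S.form A)) z.2 :=
    (((S.isTwoForm A).contDiffOn_bilinRep p.2).contDiffAt
      ((isOpen_extChartAt_target p.2).mem_nhds hz2)).differentiableAt (by simp)
  have h3 : ∀ u v w : Rk k × EuclideanSpace ℝ (Fin (n + k * n)),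
      fderiv ℝ (bilinRep p (omega S A)) z u v w
        = fderiv ℝ (bilinRep p.2 (S.form A)) z.2 u.2 v.2 w.2 := by
    intro u v w
    rw [fderiv_bilin_apply h1, fderiv_bilin_apply h2]
    have h4 : (fun z => bilinRep p (omega S A) z v w)
        =ᶠ[nhds z] fun z => bilinRep p.2 (S.form A) z.2 v.2 w.2 := by
      filter_upwards [hnhds] with z' hz'
      exact bilinRep_omega S A hz' v w
    have h5 : HasFDerivAt (fun y => bilinRep p.2 (S.form A) y v.2 w.2)
        (fderiv ℝ (fun y => bilinRep p.2 (S.form A) y v.2 w.2) z.2) z.2 :=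
      ((h2.clm_apply (differentiableAt_const v.2)).clm_apply
        (differentiableAt_const w.2)).hasFDerivAt
    have h6 := h5.comp z hasFDerivAt_snd
    rw [h4.fderiv_eq]
    exact DFunLike.congr_fun h6.fderiv u
  rw [h3, h3, h3]
  exact (S.closed A).bilinRep_closed hz2 h2 u.2 v.2 w.2

end Omega

/-! ### Conservation along solutions -/

section Conservation

variable {k n : ℕ} {M : Type*} [TopologicalSpace M]
  [ChartedSpace (EuclideanSpace ℝ (Fin (n + k * n))) M]
  [IsManifold (𝓡 (n + k * n)) ∞ M] {S : KSymplecticStructure k n M} {H : Rk k × M → ℝ}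
  {Y : VField (prodModel k n) (Rk k × M)}

/-- Hamiltonian functions `F^A` of a Noether symmetry, i.e. functions with `i(Y)ω^A = dF^A`, form
a conservation law: along a solution, `∑ ∂(F^A ∘ ψ)/∂t^A` is the field equation evaluated at `-Y`,
and `L(Y)H` and all `i(Y)η^A` vanish. -/
theorem IsInfinitesimalNoetherSymmetry.isConservationLawOn
    (hY : IsInfinitesimalNoetherSymmetry S H Y) {U : Set (Rk k × M)} (hU : IsOpen U)
    {F : Fin k → Rk k × M → ℝ} (hF : ∀ A, ContMDiffOn (prodModel k n) 𝓘(ℝ, ℝ) ∞ (F A) U)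
    (hdF : ∀ A, ∀ q ∈ U, ∀ v : TangentSpace (prodModel k n) q,
      omega S A q (Y q) v = mvfderiv (prodModel k n) (F A) q v) :
    IsConservationLawOn S H U F := by
  refine ⟨hF, fun U₀ ψ hU₀ hψ t ht htU => ?_⟩
  have hψd := (hψ.smooth.contMDiffAt (hU₀.mem_nhds ht)).mdifferentiableAt (by simp)
  have h1 : ∀ A, fderiv ℝ (fun s => F A (ψ s)) t (basisVec A)
      = - omega S A (ψ t) (pushBasis (n := n) ψ t A) (Y (ψ t)) := by
    intro A
    have hFd := ((hF A).contMDiffAt (hU.mem_nhds htU)).mdifferentiableAt (by simp)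
    rw [← omega_swap, hdF A _ htU, ← mfderiv_eq_fderiv]
    exact DFunLike.congr_fun (mfderiv_comp t hFd hψd) (basisVec A)
  have h2 : mvfderiv (prodModel k n) H (ψ t) (Y (ψ t)) = 0 := hY.lieDeriv_hamiltonian (ψ t)
  rw [divergence, Finset.sum_congr rfl fun A _ => h1 A, Finset.sum_neg_distrib,
    hψ.equation t ht, h2]
  simp [hY.eta_eq_zero]

end Conservation

end KCosymplectic

open KCosymplectic
theorem mainTheorem1 (k n : ℕ) (M : Type*) [TopologicalSpace M]
    [ChartedSpace (EuclideanSpace ℝ (Fin (n + k * n))) M]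
    [IsManifold (𝓡 (n + k * n)) ∞ M]
    (S : KSymplecticStructure k n M)
    (H : Rk k × M → ℝ) (hH : ContMDiff (prodModel k n) 𝓘(ℝ, ℝ) ∞ H)
    (Y : VField (prodModel k n) (Rk k × M))
    (hY : IsInfinitesimalNoetherSymmetry S H Y) :
    ∀ p : Rk k × M, ∃ U : Set (Rk k × M), IsOpen U ∧ p ∈ U ∧
      (∃ θ, ArePotentialsOn S U θ) ∧
      ∀ θ, ArePotentialsOn S U θ →
        (∃ ζ, AreLiePrimitivesOn Y U θ ζ) ∧
        ∀ ζ, AreLiePrimitivesOn Y U θ ζ →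
          (∀ A, ∀ q ∈ U, ∀ v : TangentSpace (prodModel k n) q,
            omega S A q (Y q) v
              = mvfderiv (prodModel k n) (noetherFunction Y θ ζ A) q v) ∧
          IsConservationLawOn S H U (noetherFunction Y θ ζ) := by
  intro p
  obtain ⟨r, hr, hball⟩ := Metric.isOpen_iff.1 (isOpen_extChartAt_target (I := prodModel k n) p)
    _ (mem_extChartAt_target p)
  have hU := isOpen_chartBall (I := prodModel k n) p (r / 2)
  refine ⟨chartBall (prodModel k n) p (r / 2), hU, mem_chartBall_self p (by linarith), ?_, ?_⟩
  · choose θ hθ using fun A => exists_potential_chartBall hr hball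
      (contDiffOn_bilinRep_omega S A) (omega_swap S A) (fun y hy => bilinRep_omega_closed S A hy)
    exact ⟨θ, hθ⟩
  intro θ hθ
  refine ⟨?_, fun ζ hζ => ?_⟩
  · choose f hf hdf using fun A => exists_hamiltonian_chartBall
      ((Metric.ball_subset_ball (by linarith)).trans hball : Metric.ball _ (r / 2) ⊆ _)
      (contDiffOn_bilinRep_omega S A) (omega_swap S A) (fun y hy => bilinRep_omega_closed S A hy)
      hY.smooth (hY.lieDeriv_omega A)
    refine ⟨fun A q => θ A q (Y q) - f A q, fun A => ⟨?_, ?_⟩⟩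
    · intro q hq
      exact ((hθ A).1.contMDiffWithinAt_apply (hY.smooth q) hq).sub (hf A q hq)
    · exact (hθ A).2.lieDerivOneEqDiffOn hU (hθ A).1 hY.smooth (hf A) (hdf A)
  · have hdF : ∀ A, ∀ q ∈ chartBall (prodModel k n) p (r / 2),
        ∀ v : TangentSpace (prodModel k n) q, omega S A q (Y q) v
          = mvfderiv (prodModel k n) (noetherFunction Y θ ζ A) q v := fun A q hq v =>
      (hζ A).2.bilin_eq_mvfderiv hU (hθ A).1 (hθ A).2 hY.smooth (hζ A).1 hq v
    exact ⟨hdF, hY.isConservationLawOn hU (fun A q hq =>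
      ((hθ A).1.contMDiffWithinAt_apply (hY.smooth q) hq).sub ((hζ A).1 q hq)) hdF⟩
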